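/- Let $f\colon\mathbb C\to\mathbb C$ be a transcendental entire function (entire and not a polynomial), let $\delta\in\mathbb C\setminus\{0\}$, and let $F\colon\mathbb C^2\to\mathbb C^2$, $F(z,w)=(f(z)-\delta w,\,z)$, be the associated transcendental Hénon map, which is an automorphism of $\mathbb C^2$. Embed $\mathbb C^2$ in the complex projective plane $\mathbb P^2$ by $(z,w)\mapsto[z:w:1]$, so that the line at infinity is $\ell^\infty=\{[z:w:0]\}$. Then $F$ has infinitely many distinct escaping orbits converging to the point $[1:0:0]\in\ell^\infty$: there are infinitely many pairwise distinct full orbits $\{F^k(P):k\in\mathbb Z\}$, $P\in\mathbb C^2$, such that, as $n\to+\infty$, $\|F^n(P)\|\to\infty$ and $F^n(P)\to[1:0:0]$ in $\mathbb P^2$. -/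

import Mathlib

open Filter Topology
open scoped LinearAlgebra.Projectivization

/-- An entire function `f : ℂ → ℂ` is transcendental if it is not a polynomial function. -/
def IsTranscendentalEntire (f : ℂ → ℂ) : Prop :=
  Differentiable ℂ f ∧ ¬ ∃ p : Polynomial ℂ, ∀ z : ℂ, f z = p.eval z

/-- The Hénon map `F(z, w) = (f(z) - δ w, z)` of `ℂ²`, with its inverse
`F⁻¹(z, w) = (w, (f(w) - z) / δ)`. It is called transcendental when `f` is entire and
transcendental. -/
noncomputable def henonMap (f : ℂ → ℂ) (δ : ℂ) (hδ : δ ≠ 0) : Equiv.Perm (ℂ × ℂ) where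
  toFun P := (f P.1 - δ * P.2, P.1)
  invFun P := (P.2, (f P.2 - P.1) / δ)
  left_inv P := by
    ext
    · rfl
    · simp [hδ]
  right_inv P := by
    ext
    · simp only
      field_simp
      ring
    · rfl

/-- The (full) orbit `{F^k(P) : k ∈ ℤ}` of a point `P` under an invertible map `F`. -/
def fullOrbit (F : Equiv.Perm (ℂ × ℂ)) (P : ℂ × ℂ) : Set (ℂ × ℂ) :=
  Set.range fun k : ℤ => (F ^ k) P

/-- The point `P` escapes under `F`: `‖F^n(P)‖ → ∞` as `n → ∞`. -/
def IsEscaping (F : Equiv.Perm (ℂ × ℂ)) (P : ℂ × ℂ) : Prop :=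
  Tendsto (fun n : ℕ => ‖F^[n] P‖) atTop atTop

/-- The complex projective plane. -/
abbrev ProjPlane : Type := ℙ ℂ (Fin 3 → ℂ)

/-- The usual topology of the projective plane: the quotient topology from `ℂ³ \ {0}`. -/
noncomputable instance ProjPlane.instTopologicalSpace : TopologicalSpace ProjPlane :=
  TopologicalSpace.coinduced (Projectivization.mk' ℂ) inferInstance

/-- The standard embedding `(z, w) ↦ [z : w : 1]` of `ℂ²` into the projective plane, whose
complement is the line at infinity `{[z : w : 0]}`. -/
noncomputable def toProjPlane (P : ℂ × ℂ) : ProjPlane :=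
  Projectivization.mk ℂ ![P.1, P.2, 1] fun h => one_ne_zero (congrFun h 2)

/-- The point `[1 : 0 : 0]` on the line at infinity. -/
noncomputable def horizontalPointAtInfinity : ProjPlane :=
  Projectivization.mk ℂ ![1, 0, 0] fun h => one_ne_zero (congrFun h 0)

/-! On each horizontal line some point escapes to [1:0:0]. These points have every second
coordinate, while countably many orbits cover only a countable set; hence there are infinitely many
orbits.

An orbit is a sequence with `x (n+2) = f (x (n+1)) - δ x n`. `exists_norm_le_mul_exp` replaces
Wiman–Valiron theory: maximizing a weighted `‖f‖` over an annulus gives a center `exp s` near which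
`f (exp (s + v/a))` is at most about `f (exp s) * exp v` in modulus, and Borel–Carathéodory turns
this into an approximate equality. Centers `exp (s n)` are chosen in annuli, each having the image
of the previous center on its inner circle. With `x (n+1) = exp (s n + ζ n / a n)`, the logarithm of
the recursion is a fixed-point equation for `ζ`, contracting because every `a n ≥ 96` and the `δ`
term is tiny. -/

/-! ### Growth of transcendental entire functions -/

/-- Taylor expansion of an entire function with entire remainder. -/
lemma exists_eq_polynomial_add_pow_mul {f : ℂ → ℂ} (hf : Differentiable ℂ f) (k : ℕ) :
    ∃ (p : Polynomial ℂ) (u : ℂ → ℂ) (D : ℝ), Differentiable ℂ u ∧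
      (∀ z, f z = p.eval z + z ^ k * u z) ∧ 0 ≤ D ∧
      ∀ r : ℝ, 1 ≤ r → ∀ z : ℂ, ‖z‖ ≤ r → ‖p.eval z‖ * r ≤ D * r ^ k := by
  induction k with
  | zero => exact ⟨0, f, 0, hf, by simp, le_rfl, by simp⟩
  | succ k ih =>
    obtain ⟨p, u, D, hu, hfu, hD, hp⟩ := ih
    -- The constant term of the remainder moves into `p`. The bound `‖p z‖ * r ≤ D * r ^ k` encodes
    -- degree below `k` without the exponent `k - 1`.
    refine ⟨p + Polynomial.C (u 0) * Polynomial.X ^ k, dslope u 0, D + ‖u 0‖, ?_, ?_, by positivity,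
      ?_⟩
    · rw [← differentiableOn_univ] at hu ⊢
      exact (Complex.differentiableOn_dslope univ_mem).mpr hu
    · intro z
      have h := sub_smul_dslope u 0 z
      simp only [sub_zero, smul_eq_mul] at h
      rw [hfu z, pow_succ, mul_assoc, h]
      simp
      ring
    · intro r hr z hz
      have h1 := hp r hr z hz
      have h2 : ‖z‖ ^ k ≤ r ^ k := pow_le_pow_left₀ (norm_nonneg z) hz k
      have h3 : ‖(p + Polynomial.C (u 0) * Polynomial.X ^ k).eval z‖
          ≤ ‖p.eval z‖ + ‖u 0‖ * r ^ k := by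
        simp only [Polynomial.eval_add, Polynomial.eval_mul, Polynomial.eval_C,
          Polynomial.eval_pow, Polynomial.eval_X]
        refine (norm_add_le _ _).trans ?_
        rw [norm_mul, norm_pow]
        gcongr
      have h4 : D * r ^ k ≤ D * r ^ k * r := le_mul_of_one_le_right (by positivity) hr
      calc _ ≤ (‖p.eval z‖ + ‖u 0‖ * r ^ k) * r := by gcongr
        _ ≤ _ := by rw [pow_succ]; nlinarith

/-- The maximum modulus of a transcendental entire function grows by any prescribed factor when
the radius is multiplied by a fixed number `q > 1`. -/
lemma IsTranscendentalEntire.exists_norm_gt {f : ℂ → ℂ} (hf : IsTranscendentalEntire f)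
    {K q : ℝ} (hK : 0 < K) (hq : 1 < q) :
    ∃ r₀ : ℝ, ∀ r ≥ r₀, ∃ z₁ : ℂ, ‖z₁‖ = q * r ∧
      ∀ z : ℂ, ‖z‖ ≤ r → K * (‖f z‖ + r ^ 2) < ‖f z₁‖ := by
  obtain ⟨k₀, hk₀⟩ := pow_unbounded_of_one_lt (K + 1) hq
  -- `q ^ k - K ≥ 1` makes the leading term win; `k ≥ 3` absorbs the summand `r ^ 2`.
  obtain ⟨k, hk, hk3⟩ : ∃ k : ℕ, K + 1 ≤ q ^ k ∧ 3 ≤ k :=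
    ⟨k₀ + 3, hk₀.le.trans (pow_le_pow_right₀ hq.le (by omega)), by omega⟩
  obtain ⟨p, u, D, hu, hfu, hD, hp⟩ := exists_eq_polynomial_add_pow_mul hf.1 k
  obtain ⟨b, hb⟩ : ∃ b, u b ≠ 0 := by
    by_contra! h
    exact hf.2 ⟨p, fun z => by rw [hfu z, h z]; simp⟩
  have hm : 0 < ‖u b‖ := norm_pos_iff.mpr hb
  refine ⟨max (max 1 ‖b‖) ((K * (D + 1) + D * q ^ k) / ‖u b‖ + 1), fun r hr => ?_⟩
  have hr1 : 1 ≤ r := (le_max_left _ _).trans ((le_max_left _ _).trans hr)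
  have hrb : ‖b‖ ≤ r := (le_max_right _ _).trans ((le_max_left _ _).trans hr)
  have hr2 : (K * (D + 1) + D * q ^ k) / ‖u b‖ < r := by
    have := (le_max_right _ _).trans hr
    linarith
  rw [div_lt_iff₀ hm] at hr2
  have hr0 : 0 < r := by linarith
  have hq0 : 0 < q := by linarith
  have hqr : r ≤ q * r := le_mul_of_one_le_left hr0.le hq.le
  -- The maximum principle is applied to the remainder `u`, not to `f`: the prefactor `z ^ k` then
  -- supplies the gain `q ^ k`.
  obtain ⟨z₁, hz₁, hmax⟩ := Complex.exists_mem_frontier_isMaxOn_norm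
    (Metric.isBounded_ball (x := (0 : ℂ)) (r := q * r))
    (Metric.nonempty_ball.mpr (by positivity)) hu.diffContOnCl
  rw [frontier_ball _ (by positivity), mem_sphere_zero_iff_norm] at hz₁
  rw [closure_ball _ (by positivity)] at hmax
  have hle : ∀ z : ℂ, ‖z‖ ≤ r → ‖u z‖ ≤ ‖u z₁‖ := fun z hz =>
    hmax (mem_closedBall_zero_iff.mpr (hz.trans hqr))
  refine ⟨z₁, hz₁, fun z hz => ?_⟩
  have hP1 := hp (q * r) (hr1.trans hqr) z₁ hz₁.le
  have hP := hp r hr1 z hz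
  have hmu := hle b hrb
  have hF1 : (q * r) ^ k * ‖u z₁‖ - ‖p.eval z₁‖ ≤ ‖f z₁‖ := by
    have : z₁ ^ k * u z₁ = f z₁ - p.eval z₁ := by rw [hfu]; ring
    have h2 := norm_sub_le (f z₁) (p.eval z₁)
    rw [← this, norm_mul, norm_pow, hz₁] at h2
    linarith
  have hF : ‖f z‖ ≤ ‖p.eval z‖ + r ^ k * ‖u z₁‖ := by
    rw [hfu z]
    refine (norm_add_le _ _).trans ?_
    rw [norm_mul, norm_pow]
    have := hle z hz
    gcongr
  have hrk : r ^ 2 * r ≤ r ^ k := by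
    rw [← pow_succ]; exact pow_le_pow_right₀ hr1 hk3
  have hrk0 : 0 < r ^ k := by positivity
  have hqk0 : 0 < q ^ k := by positivity
  rw [mul_pow] at hP1 hF1
  have hP1' : ‖p.eval z₁‖ * r ≤ D * (q ^ k * r ^ k) := by
    refine le_trans ?_ hP1
    gcongr
  refine lt_of_lt_of_le ?_ hF1
  refine lt_of_mul_lt_mul_right ?_ hr0.le
  have e1 : K * (‖f z‖ + r ^ 2) * r ≤ K * (D * r ^ k + r ^ k * ‖u z₁‖ * r + r ^ k) := by
    rw [mul_assoc]
    gcongr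
    nlinarith
  have e2 : (K * (D + 1) + D * q ^ k) < (q ^ k - K) * ‖u z₁‖ * r := by
    refine hr2.trans_le ?_
    rw [mul_comm]
    gcongr
    nlinarith [norm_nonneg (u z₁)]
  nlinarith [mul_lt_mul_of_pos_left e2 hrk0]

/-! ### Power-like behaviour in logarithmic coordinates -/

/-- Since `1/(1-y) ≤ exp (y/(1-y))` and `y/(1-y) = y + y²/(1-y)`, the error in the exponent is `N
y²/(1-y)`, which is small because `N` is large compared with `24²`. -/
lemma one_sub_inv_pow_le {N : ℕ} {y : ℝ} (hN : 10000 = N) (hy : |N * y| ≤ 24) :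
    (1 - y)⁻¹ ^ N ≤ 17 / 16 * Real.exp (N * y) := by
  have hN' : (N : ℝ) = 10000 := by rw [← hN]; norm_num
  have hy1 : |y| ≤ 24 / 10000 := by
    rw [abs_mul, hN', abs_of_pos (by norm_num)] at hy; linarith
  obtain ⟨h1, h2⟩ := abs_le.mp hy1
  have hpos : 0 < 1 - y := by linarith
  have e1 : (1 - y)⁻¹ ≤ Real.exp (y / (1 - y)) := by
    have := Real.add_one_le_exp (y / (1 - y))
    convert this using 1
    field_simp
    ring
  have e2 : (N : ℝ) * (y / (1 - y)) ≤ N * y + 586 / 10000 := by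
    rw [hN']
    have : (10000 : ℝ) * (y / (1 - y)) - 10000 * y = 10000 * y ^ 2 / (1 - y) := by
      field_simp; ring
    have h3 : 10000 * y ^ 2 / (1 - y) ≤ 586 / 10000 := by
      rw [div_le_iff₀ hpos]; nlinarith
    linarith
  calc (1 - y)⁻¹ ^ N ≤ Real.exp (y / (1 - y)) ^ N := by gcongr
    _ = Real.exp (N * (y / (1 - y))) := by rw [Real.exp_nat_mul]
    _ ≤ Real.exp (N * y + 586 / 10000) := by gcongr
    _ ≤ _ := by
      rw [Real.exp_add, mul_comm]
      gcongr
      have := Real.add_one_le_exp (-(586 / 10000 : ℝ))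
      rw [Real.exp_neg] at this
      have h5 := Real.exp_pos (586 / 10000 : ℝ)
      rw [le_inv_comm₀ (by norm_num) h5] at this
      refine this.trans (by norm_num)

/-- Near suitable points `exp s` of large modulus, a transcendental entire function grows at most
like a power `z ^ a` in logarithmic coordinates. -/
lemma IsTranscendentalEntire.exists_norm_le_mul_exp {f : ℂ → ℂ} (hf : IsTranscendentalEntire f) :
    ∃ T₀ : ℝ, ∀ T ≥ T₀, ∃ (s : ℂ) (a : ℝ), T ≤ s.re ∧ s.re ≤ T + 1 ∧ 96 ≤ a ∧
      Real.exp (2 * T) ≤ ‖f (Complex.exp s)‖ ∧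
      ∀ v : ℂ, ‖v‖ ≤ 24 →
        ‖f (Complex.exp (s + v / a))‖ ≤ 17 / 16 * ‖f (Complex.exp s)‖ * Real.exp v.re := by
  obtain ⟨N, hN⟩ : ∃ N : ℕ, 10000 = N := ⟨_, rfl⟩
  have hN' : (N : ℝ) = 10000 := by rw [← hN]; norm_num
  -- `exp 48 * 2 ^ N` is the factor by which the weight in `W` can drop from `log ‖z‖ = T` to `T +
  -- 1/2`.
  obtain ⟨r₀, hr₀⟩ := hf.exists_norm_gt (K := Real.exp 48 * 2 ^ N) (q := Real.exp (1 / 4))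
    (by positivity) (by simp)
  refine ⟨Real.log (max r₀ 1), fun T hT => ?_⟩
  have hTr : r₀ ≤ Real.exp (T + 1 / 4) := by
    have h1 : max r₀ 1 ≤ Real.exp T := by
      rwa [ge_iff_le, Real.log_le_iff_le_exp (by positivity)] at hT
    exact (le_max_left _ _).trans (h1.trans (Real.exp_le_exp.mpr (by linarith)))
  obtain ⟨z₁, hz₁, hbig⟩ := hr₀ _ hTr
  rw [← Real.exp_add, show (1 / 4 + (T + 1 / 4) : ℝ) = T + 1 / 2 by ring] at hz₁
  -- The factor `‖z‖ ^ (-96)` forces `a ≥ 96`; the last factor vanishes on the outer circle and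
  -- pushes the maximum off it.
  set W : ℂ → ℝ := fun z =>
    ‖f z‖ * Real.exp (-96 * Real.log ‖z‖) * (T + 1 - Real.log ‖z‖) ^ N with hW
  set S : Set ℂ := Metric.closedBall 0 (Real.exp (T + 1)) \ Metric.ball 0 (Real.exp T) with hS
  have hSc : IsCompact S := (isCompact_closedBall _ _).diff Metric.isOpen_ball
  have hmem : ∀ z : ℂ, z ∈ S ↔ Real.exp T ≤ ‖z‖ ∧ ‖z‖ ≤ Real.exp (T + 1) := by
    intro z; simp [hS, and_comm]
  have hWc : ContinuousOn W S := by
    have h1 : ContinuousOn (fun z : ℂ => Real.log ‖z‖) S := by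
      refine ContinuousOn.log continuous_norm.continuousOn fun z hz => ?_
      exact ((Real.exp_pos T).trans_le ((hmem z).mp hz).1).ne'
    have h2 : ContinuousOn f S := hf.1.continuous.continuousOn
    exact (h2.norm.mul (Real.continuous_exp.comp_continuousOn (continuousOn_const.mul h1))).mul
      ((continuousOn_const.sub h1).pow N)
  have hz₁S : z₁ ∈ S := by
    rw [hmem, hz₁, Real.exp_le_exp, Real.exp_le_exp]; constructor <;> linarith
  obtain ⟨z₀, hz₀, hmax⟩ := hSc.exists_isMaxOn ⟨z₁, hz₁S⟩ hWc
  obtain ⟨hl, hu⟩ := (hmem z₀).mp hz₀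
  have hz₀pos : 0 < ‖z₀‖ := (Real.exp_pos T).trans_le hl
  set t := Real.log ‖z₀‖ with ht
  have htn : ‖z₀‖ = Real.exp t := (Real.exp_log hz₀pos).symm
  rw [htn, Real.exp_le_exp] at hl hu
  have hf₁pos : 0 < ‖f z₁‖ :=
    lt_of_le_of_lt (by positivity) (hbig 0 (by simp; positivity))
  have hmax₁ : ‖f z₁‖ * Real.exp (-96 * (T + 1 / 2)) * (1 / 2) ^ N
      ≤ ‖f z₀‖ * Real.exp (-96 * t) * (T + 1 - t) ^ N := by
    have := hmax hz₁S
    simp only [hW, Set.mem_ofPred_eq, hz₁, Real.log_exp,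
      show T + 1 - (T + 1 / 2) = 1 / 2 by ring] at this
    exact this
  have hlow : ‖f z₁‖ ≤ ‖f z₀‖ * (Real.exp 48 * 2 ^ N) * (T + 1 - t) ^ N := by
    have e1 : Real.exp (-96 * t) ≤ Real.exp (-96 * (T + 1 / 2)) * Real.exp 48 := by
      rw [← Real.exp_add]; gcongr; linarith
    have h0 : 0 ≤ T + 1 - t := by linarith
    have h3 : ‖f z₁‖ * Real.exp (-96 * (T + 1 / 2)) * (1 / 2) ^ N ≤
        ‖f z₀‖ * (Real.exp (-96 * (T + 1 / 2)) * Real.exp 48) * (T + 1 - t) ^ N :=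
      hmax₁.trans (by gcongr)
    have h4 : 0 < Real.exp (-96 * (T + 1 / 2)) * (1 / 2) ^ N := by positivity
    refine le_of_mul_le_mul_right ?_ h4
    calc _ = ‖f z₁‖ * Real.exp (-96 * (T + 1 / 2)) * (1 / 2) ^ N := by ring
      _ ≤ _ := h3
      _ = ‖f z₀‖ * (Real.exp 48 * (2 ^ N * (1 / 2) ^ N)) * (T + 1 - t) ^ N
          * Real.exp (-96 * (T + 1 / 2)) := by
            rw [← mul_pow]; norm_num; ring
      _ = _ := by ring
  have hle1 : (T + 1 - t) ^ N ≤ 1 := pow_le_one₀ (by linarith) (by linarith)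
  have hKpos : 0 < Real.exp 48 * 2 ^ N := by positivity
  have hlow' : ‖f z₁‖ ≤ (Real.exp 48 * 2 ^ N) * ‖f z₀‖ := by
    refine hlow.trans ?_
    rw [mul_comm (Real.exp 48 * 2 ^ N)]
    exact mul_le_of_le_one_right (by positivity) hle1
  have htgt : T + 1 / 4 < t := by
    by_contra! h
    have := hbig z₀ (by rw [htn]; gcongr)
    have h5 := this.trans_le hlow'
    rw [mul_lt_mul_iff_right₀ hKpos] at h5
    have : 0 ≤ Real.exp (T + 1 / 4) ^ 2 := by positivity
    linarith
  have htlt : t < T + 1 := by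
    by_contra! h
    have h6 : T + 1 - t = 0 := by linarith
    rw [h6, zero_pow (by omega), mul_zero] at hlow
    linarith
  have hexp : Complex.exp (Complex.log z₀) = z₀ := Complex.exp_log (norm_pos_iff.mp hz₀pos)
  have hτ : 0 < T + 1 - t := by linarith
  -- Minus the derivative, at `t`, of the logarithm of the weight as a function of `log ‖z‖`.
  set a : ℝ := 96 + N / (T + 1 - t) with ha
  have ha96 : 96 ≤ a := by rw [ha]; linarith [show 0 ≤ (N : ℝ) / (T + 1 - t) by positivity]
  have haN : N / (T + 1 - t) ≤ a := by rw [ha]; linarith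
  have ha0 : 0 < a := by linarith
  refine ⟨Complex.log z₀, a, by rwa [Complex.log_re], by rwa [Complex.log_re], ha96, ?_, ?_⟩
  · rw [hexp]
    have := (hbig 0 (by simp; positivity)).trans_le hlow'
    rw [mul_lt_mul_iff_right₀ hKpos] at this
    have e : Real.exp (2 * T) ≤ Real.exp (T + 1 / 4) ^ 2 := by
      rw [← Real.exp_nat_mul, Real.exp_le_exp]; push_cast; linarith
    linarith [norm_nonneg (f 0)]
  · intro v hv
    rw [hexp]
    set x : ℝ := v.re / a with hx
    have hvre : |v.re| ≤ 24 := (Complex.abs_re_le_norm v).trans hv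
    have hxa : |x| * a ≤ 24 := by
      rw [hx, abs_div, abs_of_pos ha0, div_mul_cancel₀ _ ha0.ne']; exact hvre
    -- `24 / 96 = 1/4` is the distance from the inner circle secured by `htgt`.
    have hx1 : |x| ≤ 1 / 4 := by nlinarith [abs_nonneg x]
    have hy : |N * (x / (T + 1 - t))| ≤ 24 := by
      have : (N : ℝ) * (x / (T + 1 - t)) = x * (N / (T + 1 - t)) := by ring
      rw [this, abs_mul, abs_of_nonneg (show 0 ≤ (N : ℝ) / (T + 1 - t) by positivity)]
      exact (mul_le_mul_of_nonneg_left haN (abs_nonneg x)).trans hxa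
    have hNy := one_sub_inv_pow_le hN hy
    have hnorm : ‖Complex.exp (Complex.log z₀ + v / a)‖ = Real.exp (t + x) := by
      rw [Complex.norm_exp, Complex.add_re, Complex.log_re, Complex.div_ofReal_re]
    have hyle : x / (T + 1 - t) < 1 := by
      rw [abs_mul, hN', abs_of_pos (by norm_num)] at hy
      linarith [le_abs_self (x / (T + 1 - t))]
    have hxlt : 0 < T + 1 - (t + x) := by
      rw [div_lt_one hτ] at hyle; linarith
    have hzS : Complex.exp (Complex.log z₀ + v / a) ∈ S := by
      rw [hmem, hnorm, Real.exp_le_exp, Real.exp_le_exp]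
      constructor <;> linarith [(abs_le.mp hx1).1]
    have h7 := hmax hzS
    simp only [hW, Set.mem_ofPred_eq, hnorm, Real.log_exp] at h7
    rw [← ht] at h7
    have h8 : (1 - x / (T + 1 - t))⁻¹ * (T + 1 - (t + x)) = T + 1 - t := by
      have : 1 - x / (T + 1 - t) = (T + 1 - (t + x)) / (T + 1 - t) := by
        field_simp; ring
      rw [this, inv_div]; field_simp
    have h9 : 0 < Real.exp (-96 * (t + x)) * (T + 1 - (t + x)) ^ N := by positivity
    have hvx : v.re = 96 * x + N * (x / (T + 1 - t)) := by
      have : v.re = a * x := by rw [hx]; field_simp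
      rw [this, ha]; ring
    refine le_of_mul_le_mul_right ?_ h9
    calc _ = ‖f (Complex.exp (Complex.log z₀ + v / a))‖ * Real.exp (-96 * (t + x))
          * (T + 1 - (t + x)) ^ N := by ring
      _ ≤ _ := h7
      _ = ‖f z₀‖ * Real.exp (-96 * t) * ((1 - x / (T + 1 - t))⁻¹ ^ N
          * (T + 1 - (t + x)) ^ N) := by rw [← mul_pow, h8]
      _ ≤ ‖f z₀‖ * Real.exp (-96 * t) * (17 / 16 * Real.exp (N * (x / (T + 1 - t)))
          * (T + 1 - (t + x)) ^ N) := by gcongr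
      _ = 17 / 16 * ‖f z₀‖ * (Real.exp (N * (x / (T + 1 - t))) * Real.exp (-96 * t))
          * (T + 1 - (t + x)) ^ N := by ring
      _ = 17 / 16 * ‖f z₀‖ * (Real.exp v.re * Real.exp (-96 * (t + x)))
          * (T + 1 - (t + x)) ^ N := by
            rw [← Real.exp_add, ← Real.exp_add, hvx]; ring_nf
      _ = _ := by ring

/-! ### Estimates for the normalized function -/

/-- If `|h| ≤ 17/16` on a disc and `h = 1` at the center, then `h` is close to `1` on the
concentric disc of half the radius. -/
lemma norm_sub_one_le_of_norm_le {h : ℂ → ℂ} (hh : Differentiable ℂ h) (h0 : h 0 = 1)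
    (hle : ∀ v : ℂ, ‖v‖ ≤ 24 → ‖h v‖ ≤ 17 / 16) {v : ℂ} (hv : ‖v‖ ≤ 12) :
    ‖h v - 1‖ ≤ 1 / 8 := by
  -- The real part of `h - 1` is at most `1/16`, giving `2 * (1/16) * 12 / (24 - 12) = 1/8`.
  have key := Complex.borelCaratheodory_zero (f := fun z => h z - 1) (M := 1 / 16) (R := 24)
    (z := v) (by norm_num) (hh.sub_const 1).differentiableOn ?_ (by norm_num)
    (mem_ball_zero_iff.mpr (by linarith)) (by simp [h0])
  · refine key.trans ?_
    rw [div_le_iff₀ (by linarith)]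
    linarith
  · intro z hz
    have := (Complex.re_le_norm _).trans (hle z (mem_ball_zero_iff.mp hz).le)
    simp only [Set.mem_ofPred_eq, Complex.sub_re, Complex.one_re]
    linarith

/-- Bounds for the logarithm of a function close to `1`. -/
lemma norm_log_le_and_lipschitz {h : ℂ → ℂ} {r η : ℝ} (hr : 0 < r) (hη : η ≤ 1 / 2)
    (hh : Differentiable ℂ h) (hle : ∀ v : ℂ, ‖v‖ ≤ 2 * r → ‖h v - 1‖ ≤ η) :
    (∀ v : ℂ, ‖v‖ ≤ 2 * r → ‖Complex.log (h v)‖ ≤ 3 / 2 * η) ∧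
    ∀ v w : ℂ, ‖v‖ ≤ r → ‖w‖ ≤ r →
      ‖Complex.log (h v) - Complex.log (h w)‖ ≤ 3 / 2 * η / r * ‖v - w‖ := by
  have hb : ∀ v : ℂ, ‖v‖ ≤ 2 * r → ‖Complex.log (h v)‖ ≤ 3 / 2 * η := by
    intro v hv
    have h1 := Complex.norm_log_one_add_half_le_self ((hle v hv).trans hη)
    rw [add_sub_cancel] at h1
    linarith [hle v hv]
  have hd : ∀ v : ℂ, ‖v‖ ≤ 2 * r → DifferentiableAt ℂ (fun z => Complex.log (h z)) v := by
    intro v hv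
    refine (hh v).clog ?_
    have h2 : ‖h v - 1‖ < 1 := by linarith [hle v hv]
    have h3 := Complex.mem_slitPlane_of_norm_lt_one h2
    rwa [add_sub_cancel] at h3
  refine ⟨hb, fun v w hv hw => ?_⟩
  refine (convex_closedBall (0 : ℂ) r).norm_image_sub_le_of_norm_deriv_le (𝕜 := ℂ)
    (f := fun z => Complex.log (h z)) (fun x hx => hd x ?_) (fun x hx => ?_)
    (mem_closedBall_zero_iff.mpr hw) (mem_closedBall_zero_iff.mpr hv)
  · linarith [mem_closedBall_zero_iff.mp hx]
  · have hx' := mem_closedBall_zero_iff.mp hx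
    have hsub : ∀ y ∈ Metric.closedBall x r, ‖y‖ ≤ 2 * r := by
      intro y hy
      have h3 := norm_sub_norm_le y x
      rw [mem_closedBall_iff_norm] at hy
      linarith
    refine Complex.norm_deriv_le_of_forall_mem_sphere_norm_le hr ?_
      (fun y hy => hb y (hsub y (Metric.sphere_subset_closedBall hy)))
    refine DifferentiableOn.diffContOnCl fun y hy => (hd y (hsub y ?_)).differentiableWithinAt
    rwa [closure_ball _ hr.ne'] at hy

/-! ### Fixed points and convergence at infinity -/

/-- Picard iteration for sequences in a ball, with respect to the supremum distance. -/
lemma exists_fixed_sequence {R : ℝ} (hR : 0 ≤ R) (Ψ : (ℕ → ℂ) → ℕ → ℂ)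
    (hmaps : ∀ ζ : ℕ → ℂ, (∀ k, ‖ζ k‖ ≤ R) → ∀ k, ‖Ψ ζ k‖ ≤ R)
    (hlip : ∀ ζ ξ : ℕ → ℂ, (∀ k, ‖ζ k‖ ≤ R) → (∀ k, ‖ξ k‖ ≤ R) → ∀ B : ℝ,
      (∀ k, ‖ζ k - ξ k‖ ≤ B) → ∀ k, ‖Ψ ζ k - Ψ ξ k‖ ≤ B / 2) :
    ∃ ζ : ℕ → ℂ, (∀ k, ‖ζ k‖ ≤ R) ∧ ∀ k, ζ k = Ψ ζ k := by
  set Z : ℕ → ℕ → ℂ := fun n => Ψ^[n] 0 with hZ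
  have hZs : ∀ n, Z (n + 1) = Ψ (Z n) := fun n => Function.iterate_succ_apply' _ _ _
  have hZR : ∀ n k, ‖Z n k‖ ≤ R := by
    intro n
    induction n with
    | zero => intro k; simpa [hZ] using hR
    | succ n ih => rw [hZs]; exact hmaps _ ih
  have hstep : ∀ n k, ‖Z n k - Z (n + 1) k‖ ≤ 4 * R / 2 / 2 ^ n := by
    intro n
    induction n with
    | zero =>
      intro k
      have := norm_sub_le (Z 0 k) (Z 1 k)
      have h1 := hZR 0 k
      have h2 := hZR 1 k
      simp only [zero_add, pow_zero]
      linarith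
    | succ n ih =>
      intro k
      have := hlip _ _ (hZR n) (hZR (n + 1)) _ ih k
      rw [← hZs, ← hZs] at this
      refine this.trans (le_of_eq ?_)
      rw [pow_succ]; field_simp
  have hdist : ∀ k n, dist (Z n k) (Z (n + 1) k) ≤ 4 * R / 2 / 2 ^ n := fun k n => by
    rw [dist_eq_norm]; exact hstep n k
  choose ξ hξ using fun k => cauchySeq_tendsto_of_complete
    (cauchySeq_of_le_geometric_two (hdist k))
  have hξR : ∀ k, ‖ξ k‖ ≤ R := fun k =>
    le_of_tendsto (hξ k).norm (Eventually.of_forall fun n => hZR n k)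
  have hclose : ∀ n k, ‖Z n k - ξ k‖ ≤ 4 * R / 2 ^ n := fun n k => by
    rw [← dist_eq_norm]
    exact dist_le_of_le_geometric_two_of_tendsto (hdist k) (hξ k) n
  refine ⟨ξ, hξR, fun k => ?_⟩
  have hlim : Tendsto (fun n : ℕ => 4 * R / 2 ^ n / 2) atTop (𝓝 0) := by
    have : Tendsto (fun n : ℕ => 2 * R * (1 / 2 : ℝ) ^ n) atTop (𝓝 (2 * R * 0)) :=
      (tendsto_pow_atTop_nhds_zero_of_lt_one (by norm_num) (by norm_num)).const_mul _
    rw [mul_zero] at this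
    refine this.congr fun n => ?_
    rw [one_div, inv_pow]; ring
  have h1 : Tendsto (fun n => Z (n + 1) k) atTop (𝓝 (Ψ ξ k)) := by
    rw [tendsto_iff_norm_sub_tendsto_zero]
    refine squeeze_zero (fun _ => norm_nonneg _) (fun n => ?_) hlim
    rw [hZs]
    exact hlip _ _ (hZR n) hξR _ (hclose n) k
  exact tendsto_nhds_unique ((tendsto_add_atTop_iff_nat 1).mpr (hξ k)) h1

/-- Convergence to `[1 : 0 : 0]` in the projective plane, in affine coordinates. -/
lemma tendsto_toProjPlane {P : ℕ → ℂ × ℂ} (hP : ∀ n, (P n).1 ≠ 0)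
    (h1 : Tendsto (fun n => (P n).2 / (P n).1) atTop (𝓝 0))
    (h2 : Tendsto (fun n => ((P n).1)⁻¹) atTop (𝓝 0)) :
    Tendsto (fun n => toProjPlane (P n)) atTop (𝓝 horizontalPointAtInfinity) := by
  have hne : ∀ x y : ℂ, (![1, x, y] : Fin 3 → ℂ) ≠ 0 := fun x y h => one_ne_zero (congrFun h 0)
  have hcont : Continuous (Projectivization.mk' ℂ : {v : Fin 3 → ℂ // v ≠ 0} → ProjPlane) :=
    continuous_coinduced_rng
  have hlim : Tendsto (fun n => (⟨![1, (P n).2 / (P n).1, ((P n).1)⁻¹], hne _ _⟩ :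
      {v : Fin 3 → ℂ // v ≠ 0})) atTop (𝓝 ⟨![1, 0, 0], hne 0 0⟩) := by
    rw [tendsto_subtype_rng, tendsto_pi_nhds]
    intro i
    fin_cases i
    · exact tendsto_const_nhds
    · exact h1
    · exact h2
  have h3 := (hcont.tendsto _).comp hlim
  refine h3.congr fun n => ?_
  simp only [Function.comp_apply, Projectivization.mk'_eq_mk, toProjPlane]
  rw [Projectivization.mk_eq_mk_iff']
  refine ⟨((P n).1)⁻¹, ?_⟩
  ext i
  fin_cases i
  · simp [hP n]
  · simp [div_eq_inv_mul]
  · simp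

/-! ### Construction of the escaping sequence -/

/-- For every initial value `w` the recursion `x (n + 2) = f (x (n + 1)) - δ * x n` has a solution
starting at `w` and growing faster than any geometric sequence. -/
lemma IsTranscendentalEntire.exists_escaping_sequence {f : ℂ → ℂ} (hf : IsTranscendentalEntire f)
    (δ w : ℂ) :
    ∃ x : ℕ → ℂ, x 0 = w ∧ (∀ n, x (n + 2) = f (x (n + 1)) - δ * x n) ∧
      (∀ n : ℕ, Real.exp n ≤ ‖x (n + 1)‖) ∧
      ∀ n : ℕ, ‖x (n + 1)‖ ≤ Real.exp (2 - n) * ‖x (n + 2)‖ := by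
  obtain ⟨T', hT'⟩ := hf.exists_norm_le_mul_exp
  choose! σ α hσ using hT'
  -- The last entry makes all perturbation coefficients `c n` at most `1/128`; the factor `1 + ‖w‖`
  -- covers both `n = 0` and `n > 0`.
  set T₀ : ℝ := max T' (max 1 (128 * (‖δ‖ * (1 + ‖w‖)))) with hT₀
  have hT₀1 : 1 ≤ T₀ := (le_max_left _ _).trans (le_max_right _ _)
  have hT₀δ : ‖δ‖ * (1 + ‖w‖) * Real.exp (-T₀) ≤ 1 / 128 := by
    have h1 : 128 * (‖δ‖ * (1 + ‖w‖)) ≤ T₀ := (le_max_right _ _).trans (le_max_right _ _)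
    have h2 := Real.add_one_le_exp T₀
    rw [Real.exp_neg, ← div_eq_mul_inv, div_le_iff₀ (Real.exp_pos _)]
    linarith
  -- The image of the `n`-th center lies on the inner circle of the next annulus.
  set T : ℕ → ℝ := fun n => (fun t => Real.log ‖f (Complex.exp (σ t))‖)^[n] T₀ with hT
  have hTs : ∀ n, T (n + 1) = Real.log ‖f (Complex.exp (σ (T n)))‖ := fun n =>
    Function.iterate_succ_apply' _ _ _
  have hdouble : ∀ n, T' ≤ T n → 2 * T n ≤ T (n + 1) := fun n hn => by
    have h := (hσ (T n) hn).2.2.2.1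
    rw [hTs, Real.le_log_iff_exp_le ((Real.exp_pos _).trans_le h)]
    exact h
  have hTge : ∀ n, T₀ ≤ T n := by
    intro n
    induction n with
    | zero => exact le_rfl
    | succ n ih => linarith [hdouble n ((le_max_left _ _).trans ih)]
  have hTT' : ∀ n, T' ≤ T n := fun n => (le_max_left _ _).trans (hTge n)
  have hT2 : ∀ n, 2 * T n ≤ T (n + 1) := fun n => hdouble n (hTT' n)
  have hTn : ∀ n : ℕ, (n : ℝ) + 1 ≤ T n := by
    intro n
    induction n with
    | zero => simpa using hT₀1.trans (hTge 0)
    | succ n ih => push_cast; linarith [hT2 n, (Nat.cast_nonneg n : (0 : ℝ) ≤ n)]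
  set s : ℕ → ℂ := fun n => σ (T n) with hs
  set a : ℕ → ℝ := fun n => α (T n) with ha
  have hs1 : ∀ n, T n ≤ (s n).re := fun n => (hσ _ (hTT' n)).1
  have hs2 : ∀ n, (s n).re ≤ T n + 1 := fun n => (hσ _ (hTT' n)).2.1
  have ha1 : ∀ n, 96 ≤ a n := fun n => (hσ _ (hTT' n)).2.2.1
  have hfpos : ∀ n, 0 < ‖f (Complex.exp (s n))‖ := fun n =>
    (Real.exp_pos _).trans_le (hσ _ (hTT' n)).2.2.2.1
  have hf0 : ∀ n, f (Complex.exp (s n)) ≠ 0 := fun n => norm_pos_iff.mp (hfpos n)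
  have hfT : ∀ n, ‖f (Complex.exp (s n))‖ = Real.exp (T (n + 1)) := fun n => by
    rw [hTs, Real.exp_log (hfpos n)]
  -- the logarithmic position of the next center relative to the image of the current one
  set l : ℕ → ℂ := fun n => Complex.log (Complex.exp (s (n + 1)) / f (Complex.exp (s n))) with hl
  have hlexp : ∀ n, Complex.exp (l n) = Complex.exp (s (n + 1)) / f (Complex.exp (s n)) :=
    fun n => Complex.exp_log (div_ne_zero (Complex.exp_ne_zero _) (hf0 n))
  have hlnorm : ∀ n, ‖l n‖ ≤ 21 / 5 := by
    intro n
    have hre : (l n).re = (s (n + 1)).re - T (n + 1) := by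
      rw [hl, Complex.log_re, norm_div, Complex.norm_exp, hfT, ← Real.exp_sub, Real.log_exp]
    have him : |(l n).im| ≤ Real.pi := by
      rw [hl, Complex.log_im]; exact Complex.abs_arg_le_pi _
    have habs : |(l n).re| ≤ 1 := by
      rw [hre, abs_le]; constructor <;> linarith [hs1 (n + 1), hs2 (n + 1)]
    have := Complex.norm_le_abs_re_add_abs_im (l n)
    linarith [Real.pi_lt_d2]
  -- the function `f` in logarithmic coordinates, divided by its leading behaviour
  set h : ℕ → ℂ → ℂ := fun n v =>
    f (Complex.exp (s n + v / a n)) * Complex.exp (-v) / f (Complex.exp (s n)) with hh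
  have hhd : ∀ n, Differentiable ℂ (h n) := by
    intro n
    have h1 := hf.1
    have h2 : Differentiable ℂ fun v : ℂ => Complex.exp (s n + v / a n) := by fun_prop
    exact ((h1.comp h2).mul (by fun_prop)).div_const _
  have hh0 : ∀ n, h n 0 = 1 := fun n => by simp [hh, hf0 n]
  have hhle : ∀ n, ∀ v : ℂ, ‖v‖ ≤ 24 → ‖h n v‖ ≤ 17 / 16 := by
    intro n v hv
    have h1 := (hσ _ (hTT' n)).2.2.2.2 v hv
    simp only [hh, norm_div, norm_mul, Complex.norm_exp, Complex.neg_re]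
    rw [div_le_iff₀ (hfpos n), Real.exp_neg, ← div_eq_mul_inv, div_le_iff₀ (Real.exp_pos _)]
    exact h1
  have hhsub : ∀ n, ∀ v : ℂ, ‖v‖ ≤ 2 * 6 → ‖h n v - 1‖ ≤ 1 / 8 := fun n v hv =>
    norm_sub_one_le_of_norm_le (hhd n) (hh0 n) (hhle n) (by linarith)
  have hH := fun n => norm_log_le_and_lipschitz (by norm_num) (by norm_num) (hhd n) (hhsub n)
  -- the perturbation by `δ`
  set c : ℕ → ℂ := fun n => Nat.casesOn n (δ * w * Complex.exp (-s 1))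
    fun k => δ * Complex.exp (s k - s (k + 2))
  -- `c n * exp (θ ζ n)` equals `δ * x n / x (n+2)`. Index 0 is separate because `x 0 = w` may
  -- vanish and have no logarithm.
  set θ : (ℕ → ℂ) → ℕ → ℂ := fun ζ n => Nat.casesOn n (-(ζ 1 / a 1))
    fun k => ζ k / a k - ζ (k + 2) / a (k + 2)
  have hc0 : c 0 = δ * w * Complex.exp (-s 1) := rfl
  have hcs : ∀ k, c (k + 1) = δ * Complex.exp (s k - s (k + 2)) := fun k => rfl
  have hθ0 : ∀ ζ, θ ζ 0 = -(ζ 1 / a 1) := fun ζ => rfl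
  have hθs : ∀ ζ k, θ ζ (k + 1) = ζ k / a k - ζ (k + 2) / a (k + 2) := fun ζ k => rfl
  have hcle : ∀ n, ‖c n‖ ≤ 1 / 128 := by
    intro n
    refine le_trans ?_ hT₀δ
    cases n with
    | zero =>
      simp only [hc0, norm_mul, Complex.norm_exp, Complex.neg_re]
      have : -(s 1).re ≤ -T₀ := by linarith [hs1 1, hTge 1]
      gcongr
      linarith
    | succ k =>
      simp only [hcs, norm_mul, Complex.norm_exp, Complex.sub_re]
      have h1 : (s k).re - (s (k + 2)).re ≤ -T₀ := by
        have e : 2 * T (k + 1) ≤ T (k + 2) := hT2 (k + 1)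
        linarith [hs2 k, hs1 (k + 2), hT2 k, hTge k]
      gcongr
      exact le_mul_of_one_le_right (norm_nonneg _) (by linarith [norm_nonneg w])
  have hexp2 : Real.exp 2 ≤ 8 := by
    have h1 := Real.exp_one_lt_d9
    have h2 : Real.exp 2 = Real.exp 1 * Real.exp 1 := by rw [← Real.exp_add]; norm_num
    nlinarith [Real.exp_pos 1]
  have hQ := fun n => norm_log_le_and_lipschitz (h := fun v => 1 + c n * Complex.exp v) (r := 1)
    (η := 1 / 16) (by norm_num) (by norm_num) (by fun_prop) (fun v hv => by
      rw [add_sub_cancel_left, norm_mul, Complex.norm_exp]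
      have h1 : Real.exp v.re ≤ 8 := (Real.exp_le_exp.mpr
        ((Complex.re_le_norm v).trans (by linarith))).trans hexp2
      have h2 := mul_le_mul (hcle n) h1 (Real.exp_pos _).le (by norm_num)
      linarith)
  have hdiv : ∀ (n : ℕ) (v : ℂ) (B : ℝ), ‖v‖ ≤ B → ‖v / a n‖ ≤ B / 96 := by
    intro n v B hv
    have h96 := ha1 n
    rw [norm_div, Complex.norm_real, Real.norm_eq_abs, abs_of_pos (by linarith)]
    have := (norm_nonneg v).trans hv
    gcongr
  have hθle : ∀ ζ : ℕ → ℂ, (∀ k, ‖ζ k‖ ≤ 6) → ∀ k, ‖θ ζ k‖ ≤ 1 := by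
    intro ζ hζ k
    cases k with
    | zero =>
      have := hdiv 1 _ _ (hζ 1)
      rw [hθ0, norm_neg]
      linarith
    | succ k =>
      have h1 := hdiv k _ _ (hζ k)
      have h2 := hdiv (k + 2) _ _ (hζ (k + 2))
      exact (norm_sub_le _ _).trans (by linarith)
  have hθlip : ∀ ζ ξ : ℕ → ℂ, ∀ B : ℝ, (∀ k, ‖ζ k - ξ k‖ ≤ B) →
      ∀ k, ‖θ ζ k - θ ξ k‖ ≤ B / 48 := by
    intro ζ ξ B hB k
    have hB0 : 0 ≤ B := (norm_nonneg _).trans (hB 0)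
    cases k with
    | zero =>
      have h1 := hdiv 1 _ _ (hB 1)
      have e : θ ζ 0 - θ ξ 0 = -((ζ 1 - ξ 1) / a 1) := by rw [hθ0, hθ0]; ring
      rw [e, norm_neg]
      linarith
    | succ k =>
      have h1 := hdiv k _ _ (hB k)
      have h2 := hdiv (k + 2) _ _ (hB (k + 2))
      have e : θ ζ (k + 1) - θ ξ (k + 1)
          = (ζ k - ξ k) / a k - (ζ (k + 2) - ξ (k + 2)) / a (k + 2) := by
        rw [hθs, hθs]; ring
      rw [e]
      exact (norm_sub_le _ _).trans (by linarith)
  -- The logarithm of `f (x (n+1)) = x (n+2) * (1 + δ x n / x (n+2))`, solved for `ζ n`. Radius 6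
  -- exceeds `21/5` plus the small corrections and keeps `ζ n` in the half-disc radius where `log h`
  -- is Lipschitz.
  obtain ⟨ζ, hζ, hfix⟩ := exists_fixed_sequence (R := 6) (by norm_num)
    (fun ζ k => l k + ζ (k + 1) / a (k + 1) + Complex.log (1 + c k * Complex.exp (θ ζ k))
      - Complex.log (h k (ζ k)))
    (fun ζ hζ k => by
      have h1 := hlnorm k
      have h2 := hdiv (k + 1) _ _ (hζ (k + 1))
      have h3 := (hQ k).1 (θ ζ k) ((hθle ζ hζ k).trans (by norm_num))
      have h4 := (hH k).1 (ζ k) ((hζ k).trans (by norm_num))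
      refine (norm_sub_le _ _).trans ?_
      have h5 := norm_add₃_le (a := l k) (b := ζ (k + 1) / a (k + 1))
        (c := Complex.log (1 + c k * Complex.exp (θ ζ k)))
      linarith)
    (fun ζ ξ hζ hξ B hB k => by
      have hB0 : 0 ≤ B := (norm_nonneg _).trans (hB 0)
      have h1 := hdiv (k + 1) _ _ (hB (k + 1))
      have h2 := (hQ k).2 _ _ (hθle ζ hζ k) (hθle ξ hξ k)
      have h3 := (hH k).2 _ _ (hζ k) (hξ k)
      have h4 := hθlip ζ ξ B hB k
      have h5 := hB k
      have e : ∀ p q₁ q₂ r₁ r₂ t₁ t₂ b : ℂ, p + q₁ / b + r₁ - t₁ - (p + q₂ / b + r₂ - t₂)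
          = (q₁ - q₂) / b + (r₁ - r₂) + -(t₁ - t₂) := fun _ _ _ _ _ _ _ _ => by ring
      simp only [e]
      refine norm_add₃_le.trans ?_
      rw [norm_neg]
      linarith)
  set x : ℕ → ℂ := fun n => Nat.casesOn n w fun k => Complex.exp (s k + ζ k / a k) with hx
  have hxs : ∀ k, x (k + 1) = Complex.exp (s k + ζ k / a k) := fun k => rfl
  have hx1 : ∀ k, Real.exp (T k - 1) ≤ ‖x (k + 1)‖ := by
    intro k
    rw [hxs, Complex.norm_exp, Real.exp_le_exp, Complex.add_re]
    have h1 := hdiv k _ _ (hζ k)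
    linarith [(abs_le.mp (Complex.abs_re_le_norm (ζ k / a k))).1, hs1 k]
  have hx2 : ∀ k, ‖x (k + 1)‖ ≤ Real.exp (T k + 2) := by
    intro k
    rw [hxs, Complex.norm_exp, Real.exp_le_exp, Complex.add_re]
    have h1 := hdiv k _ _ (hζ k)
    linarith [Complex.re_le_norm (ζ k / a k), hs2 k]
  refine ⟨x, rfl, fun n => ?_, fun n => ?_, fun n => ?_⟩
  · have hδx : x (n + 2) * (c n * Complex.exp (θ ζ n)) = δ * x n := by
      cases n with
      | zero =>
        have e : Complex.exp (s 1 + ζ 1 / a 1)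
            * (Complex.exp (-s 1) * Complex.exp (-(ζ 1 / a 1))) = 1 := by
          rw [← Complex.exp_add, ← Complex.exp_add]
          ring_nf
          exact Complex.exp_zero
        calc _ = δ * w * (Complex.exp (s 1 + ζ 1 / a 1)
            * (Complex.exp (-s 1) * Complex.exp (-(ζ 1 / a 1)))) := by
              rw [hc0, hθ0, hxs]; ring
          _ = δ * w := by rw [e, mul_one]
      | succ k =>
        have e : Complex.exp (s (k + 2) + ζ (k + 2) / a (k + 2))
            * (Complex.exp (s k - s (k + 2)) * Complex.exp (ζ k / a k - ζ (k + 2) / a (k + 2)))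
            = Complex.exp (s k + ζ k / a k) := by
          rw [← Complex.exp_add, ← Complex.exp_add]
          ring_nf
        calc _ = δ * (Complex.exp (s (k + 2) + ζ (k + 2) / a (k + 2))
            * (Complex.exp (s k - s (k + 2))
              * Complex.exp (ζ k / a k - ζ (k + 2) / a (k + 2)))) := by
              rw [hcs, hθs, hxs]; ring
          _ = _ := by rw [e]
    have hne1 : 1 + c n * Complex.exp (θ ζ n) ≠ 0 := by
      intro h0
      have h1 : x (n + 2) ≠ 0 := Complex.exp_ne_zero _
      have h2 : ‖c n * Complex.exp (θ ζ n)‖ ≤ 1 / 128 * 8 := by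
        rw [norm_mul, Complex.norm_exp]
        gcongr
        · exact hcle n
        · refine (Real.exp_le_exp.mpr ?_).trans hexp2
          linarith [Complex.re_le_norm (θ ζ n), hθle ζ hζ n]
      rw [show c n * Complex.exp (θ ζ n) = -1 by linear_combination h0, norm_neg, norm_one] at h2
      norm_num at h2
    have hne2 : h n (ζ n) ≠ 0 := by
      intro h0
      have := hhsub n (ζ n) ((hζ n).trans (by norm_num))
      rw [h0, zero_sub, norm_neg, norm_one] at this
      norm_num at this
    have key : Complex.exp (ζ n) * h n (ζ n) = Complex.exp (l n)
        * Complex.exp (ζ (n + 1) / a (n + 1)) * (1 + c n * Complex.exp (θ ζ n)) := by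
      have h1 : ζ n + Complex.log (h n (ζ n)) = l n + ζ (n + 1) / a (n + 1)
          + Complex.log (1 + c n * Complex.exp (θ ζ n)) := by
        linear_combination hfix n
      have h2 := congrArg Complex.exp h1
      rwa [Complex.exp_add, Complex.exp_add, Complex.exp_add, Complex.exp_log hne1,
        Complex.exp_log hne2] at h2
    have hleft : Complex.exp (ζ n) * h n (ζ n) = f (x (n + 1)) / f (Complex.exp (s n)) := by
      have e : Complex.exp (ζ n) * Complex.exp (-ζ n) = 1 := by
        rw [← Complex.exp_add, add_neg_cancel, Complex.exp_zero]
      calc _ = (Complex.exp (ζ n) * Complex.exp (-ζ n)) * f (x (n + 1))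
          / f (Complex.exp (s n)) := by simp only [hh, hxs]; ring
        _ = _ := by rw [e, one_mul]
    rw [hleft, hlexp] at key
    have hx' : x (n + 2) = Complex.exp (s (n + 1)) * Complex.exp (ζ (n + 1) / a (n + 1)) := by
      rw [← Complex.exp_add]
    have hfx : f (x (n + 1)) = x (n + 2) * (1 + c n * Complex.exp (θ ζ n)) := by
      rw [hx']
      have := hf0 n
      field_simp at key
      linear_combination key
    rw [hfx, ← hδx]
    ring
  · refine le_trans (Real.exp_le_exp.mpr ?_) (hx1 n)
    linarith [hTn n]
  · refine (hx2 n).trans ?_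
    calc Real.exp (T n + 2) ≤ Real.exp (2 - n) * Real.exp (T (n + 1) - 1) := by
          rw [← Real.exp_add, Real.exp_le_exp]
          linarith [hTn n, hT2 n]
      _ ≤ _ := by gcongr; exact hx1 (n + 1)

/-! ### Escaping points and counting of orbits -/

/-- The orbit of a point under a permutation is countable. -/
lemma countable_fullOrbit (F : Equiv.Perm (ℂ × ℂ)) (P : ℂ × ℂ) : (fullOrbit F P).Countable :=
  Set.countable_range _

/-- On every horizontal line there is a point escaping to `[1 : 0 : 0]`. -/
lemma IsTranscendentalEntire.exists_isEscaping {f : ℂ → ℂ} (hf : IsTranscendentalEntire f)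
    (δ : ℂ) (hδ : δ ≠ 0) (w : ℂ) :
    ∃ z : ℂ, IsEscaping (henonMap f δ hδ) (z, w) ∧
      Tendsto (fun n : ℕ => toProjPlane ((henonMap f δ hδ)^[n] (z, w))) atTop
        (𝓝 horizontalPointAtInfinity) := by
  obtain ⟨x, hx0, hrec, hexp, hratio⟩ := hf.exists_escaping_sequence δ w
  have horb : ∀ n : ℕ, (henonMap f δ hδ)^[n] (x 1, w) = (x (n + 1), x n) := by
    intro n
    induction n with
    | zero => simp [hx0]
    | succ n ih =>
      rw [Function.iterate_succ_apply', ih, hrec]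
      rfl
  have hnorm : Tendsto (fun n : ℕ => ‖x (n + 1)‖) atTop atTop :=
    tendsto_atTop_mono hexp (Real.tendsto_exp_atTop.comp tendsto_natCast_atTop_atTop)
  have hne : ∀ n, x (n + 1) ≠ 0 := fun n =>
    norm_pos_iff.mp ((Real.exp_pos _).trans_le (hexp n))
  refine ⟨x 1, ?_, ?_⟩
  · unfold IsEscaping
    simp only [horb]
    exact tendsto_atTop_mono (fun n => norm_fst_le (x (n + 1), x n)) hnorm
  · simp only [horb]
    refine tendsto_toProjPlane hne ?_ ?_
    · refine (tendsto_add_atTop_iff_nat 1).mp ?_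
      have hlim : Tendsto (fun n : ℕ => Real.exp (2 - n)) atTop (𝓝 0) :=
        Real.tendsto_exp_atBot.comp
          (tendsto_const_nhds.add_atBot
            (tendsto_neg_atTop_atBot.comp tendsto_natCast_atTop_atTop))
      refine squeeze_zero_norm (fun n => ?_) hlim
      rw [norm_div, div_le_iff₀ (norm_pos_iff.mpr (hne (n + 1)))]
      exact hratio n
    · rw [tendsto_zero_iff_norm_tendsto_zero]
      simp only [norm_inv]
      exact hnorm.inv_tendsto_atTop

theorem mainTheorem3 (f : ℂ → ℂ) (hf : IsTranscendentalEntire f) (δ : ℂ) (hδ : δ ≠ 0) :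
    {O : Set (ℂ × ℂ) | ∃ P : ℂ × ℂ,
      O = fullOrbit (henonMap f δ hδ) P ∧
      IsEscaping (henonMap f δ hδ) P ∧
      Tendsto (fun n : ℕ => toProjPlane ((henonMap f δ hδ)^[n] P)) atTop
        (𝓝 horizontalPointAtInfinity)}.Infinite := by

  intro hfin
  have hcount : (⋃₀ {O : Set (ℂ × ℂ) | ∃ P : ℂ × ℂ,
      O = fullOrbit (henonMap f δ hδ) P ∧
      IsEscaping (henonMap f δ hδ) P ∧
      Tendsto (fun n : ℕ => toProjPlane ((henonMap f δ hδ)^[n] P)) atTop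
        (𝓝 horizontalPointAtInfinity)}).Countable := by
    refine hfin.countable.sUnion ?_
    rintro O ⟨P, rfl, -⟩
    exact countable_fullOrbit _ P
  -- The union of the orbits would be countable, yet it projects onto all of `ℂ`.
  refine (not_countable_complex (hcount.image Prod.snd |>.mono ?_))
  intro w _
  obtain ⟨z, hz₁, hz₂⟩ := hf.exists_isEscaping δ hδ w
  exact ⟨(z, w), ⟨_, ⟨(z, w), rfl, hz₁, hz₂⟩, ⟨0, by simp⟩⟩, rfl⟩
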